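/- Theorem 4.1. For $d\in\mathbb Z\setminus\{0\}$ let $T_d:\mathbb C^3\to\mathbb C^3$ be the Chebyshev endomorphism of type $A_3$: if $z_1,z_2,z_3$ are the first three elementary symmetric polynomials of $t_1,\dots,t_4$ with $t_1t_2t_3t_4=1$, then $T_d(z_1,z_2,z_3)=(z_1^{(d)},z_2^{(d)},z_3^{(d)})$ consists of the first three elementary symmetric polynomials of $t_1^d,\dots,t_4^d$, written as polynomials in $z_1,z_2,z_3$. Let $f_d:\mathbb C^3\to\mathbb C^3$ be $T_d$ in the coordinates $x,y,z$ given by $z_1=x+iy$, $z_2=z$, $z_3=x-iy$. Let $D_4\subset GL(3,\mathbb C)$ be the dihedral group of order $8$ generated by $R:(x,y,z)\mapsto(-y,x,-z)$ and $C:(x,y,z)\mapsto(x,-y,z)$, and let $$p=x^2+y^2,\quad q=z^2,\quad r=z(x^2-y^2),\quad s=(x^2-y^2)^2$$ be its fundamental invariants. The map $F=(p,q,r,s)$ induces a bijection from the orbit space $\mathbb C^3/D_4$ onto the quadric hypersurface $X_Q=\{(p,q,r,s)\in\mathbb C^4: r^2=qs\}$, and $f_d$ maps $D_4$-orbits into $D_4$-orbits,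 so that it induces a map $g_d:X_Q\to X_Q$, the unique map with $g_d\circ F=F\circ f_d$. Then for every $d\in\mathbb Z\setminus\{0\}$ the map $g_d:X_Q\to X_Q$ is a morphism defined over $\mathbb Z$: there are $P_1,\dots,P_4\in\mathbb Z[p,q,r,s]$ with $g_d(v)=(P_1(v),P_2(v),P_3(v),P_4(v))$ for all $v\in X_Q$. -/

import Mathlib

namespace ChebyshevDihedral

open MvPolynomial

/-! Chebyshev endomorphisms of type `A_n` -/

/-- The polynomial `z_j^{(d)} ∈ ℤ[z_1, …, z_n]` (here `j` is counted from `0`): the `j`-th elementary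
symmetric polynomial of `t_1 ^ d, …, t_{n+1} ^ d`, written as a polynomial in the elementary
symmetric polynomials of `t_1, …, t_{n+1}`, where the last one, `t_1 ⋯ t_{n+1}`, is set to `1`. -/
noncomputable def zPoly (n d : ℕ) (j : Fin n) : MvPolynomial (Fin n) ℤ :=
  bind₁ (Fin.snoc (α := fun _ => MvPolynomial (Fin n) ℤ) X 1)
    ((esymmAlgEquiv (σ := Fin (n + 1)) ℤ (Fintype.card_fin (n + 1))).symm
      ⟨expand d (esymm (Fin (n + 1)) ℤ (j + 1)), fun e => by
        rw [rename_expand, (esymm_isSymmetric (Fin (n + 1)) ℤ (j + 1)) e]⟩)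

/-- The Chebyshev endomorphism `T_d` of `ℂⁿ`, for `d ∈ ℤ`; for negative indices
`T_{-d}(z_1, …, z_n) = T_d(z_n, …, z_1)`. -/
noncomputable def chebyshev (n : ℕ) (d : ℤ) (z : Fin n → ℂ) : Fin n → ℂ :=
  fun j => aeval (if 0 ≤ d then z else z ∘ Fin.rev) (zPoly n d.natAbs j)

/-- The linear change of coordinates `z_1 = x + i y`, `z_2 = z`, `z_3 = x - i y` of `ℂ³`. For real
`(x, y, z)` it parametrizes the real subspace `z_3 = conj z_1`, `z_2 = conj z_2`. -/
noncomputable def coord : (Fin 3 → ℂ) ≃ (Fin 3 → ℂ) where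
  toFun x := ![x 0 + Complex.I * x 1, x 2, x 0 - Complex.I * x 1]
  invFun z := ![(z 0 + z 2) / 2, (z 0 - z 2) / (2 * Complex.I), z 1]
  left_inv x := by
    funext i
    fin_cases i
    · simp
    · simp
      field_simp [Complex.I_ne_zero]
      ring
    · simp
  right_inv z := by
    have hI := Complex.I_ne_zero
    funext i
    fin_cases i
    · simp
      field_simp
      ring
    · simp
    · simp
      field_simp
      ring

/-- The map `T_d` on `ℂ³` in the coordinates `(x, y, z)`. -/
noncomputable def f (d : ℤ) (x : Fin 3 → ℂ) : Fin 3 → ℂ :=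
  coord.symm (chebyshev 3 d (coord x))

/-! The dihedral group and its orbit space -/

/-- The rotation `R = diag(rotation by π/2, -1)`; in the coordinates `z_j` it is
`(z_1, z_2, z_3) ↦ (i z_1, i² z_2, i³ z_3)`. -/
def rot : GL (Fin 3) ℂ where
  val := !![0, -1, 0; 1, 0, 0; 0, 0, -1]
  inv := !![0, 1, 0; -1, 0, 0; 0, 0, -1]
  val_inv := by
    ext i j
    fin_cases i <;> fin_cases j <;> simp [Matrix.mul_apply, Fin.sum_univ_three]
  inv_val := by
    ext i j
    fin_cases i <;> fin_cases j <;> simp [Matrix.mul_apply, Fin.sum_univ_three]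

/-- The reflection `C = diag(1, -1, 1)`. -/
def refl : GL (Fin 3) ℂ where
  val := !![1, 0, 0; 0, -1, 0; 0, 0, 1]
  inv := !![1, 0, 0; 0, -1, 0; 0, 0, 1]
  val_inv := by
    ext i j
    fin_cases i <;> fin_cases j <;> simp [Matrix.mul_apply, Fin.sum_univ_three]
  inv_val := by
    ext i j
    fin_cases i <;> fin_cases j <;> simp [Matrix.mul_apply, Fin.sum_univ_three]

/-- The dihedral group `D₄ = ⟨R, C⟩` of order `8`. -/
def D4 : Subgroup (GL (Fin 3) ℂ) := Subgroup.closure {rot, refl}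

/-- Lying in the same `D₄`-orbit of `ℂ³`. -/
def orbitSetoid : Setoid (Fin 3 → ℂ) where
  r a b := ∃ A ∈ D4, A.val.mulVec a = b
  iseqv :=
    { refl := fun a => ⟨1, D4.one_mem, by simp⟩
      symm := by
        rintro a b ⟨A, hA, rfl⟩
        refine ⟨A⁻¹, D4.inv_mem hA, ?_⟩
        rw [Matrix.mulVec_mulVec, ← Units.val_mul, inv_mul_cancel, Units.val_one,
          Matrix.one_mulVec]
      trans := by
        rintro a b c ⟨A, hA, rfl⟩ ⟨B, hB, rfl⟩
        exact ⟨B * A, D4.mul_mem hB hA, by rw [Matrix.mulVec_mulVec, Units.val_mul]⟩ }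

/-- The orbit space `ℂ³ / D₄`. -/
def OrbitSpace : Type := Quotient orbitSetoid

/-! The invariants and the orbit variety -/

/-- `p = x² + y²`, `q = z²`, `r = z (x² - y²)`, `s = (x² - y²)²`. -/
noncomputable def invariants : Fin 4 → MvPolynomial (Fin 3) ℤ :=
  ![X 0 ^ 2 + X 1 ^ 2, X 2 ^ 2, X 2 * (X 0 ^ 2 - X 1 ^ 2), (X 0 ^ 2 - X 1 ^ 2) ^ 2]

/-- The quadric hypersurface `X_Q = V(r² - q s) ⊆ ℂ⁴`. -/
def XQ : Set (Fin 4 → ℂ) := {v | v 2 ^ 2 - v 1 * v 3 = 0}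

/-- The map `F : ℂ³ → X_Q`, `a ↦ (p(a), q(a), r(a), s(a))`. -/
noncomputable def F (a : Fin 3 → ℂ) : XQ :=
  ⟨fun j => aeval a (invariants j), by simp [XQ, invariants]; ring⟩

theorem F_val (a : Fin 3 → ℂ) : (F a).1 = ![a 0 ^ 2 + a 1 ^ 2, a 2 ^ 2,
    a 2 * (a 0 ^ 2 - a 1 ^ 2), (a 0 ^ 2 - a 1 ^ 2) ^ 2] := by
  funext j
  fin_cases j <;> simp [F, invariants]

theorem rot_mulVec (a : Fin 3 → ℂ) : rot.val.mulVec a = ![-a 1, a 0, -a 2] := by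
  funext i
  fin_cases i <;> simp [rot, Matrix.mulVec, dotProduct, Fin.sum_univ_three]

theorem refl_mulVec (a : Fin 3 → ℂ) : refl.val.mulVec a = ![a 0, -a 1, a 2] := by
  funext i
  fin_cases i <;> simp [refl, Matrix.mulVec, dotProduct, Fin.sum_univ_three]

theorem rot_mem : rot ∈ D4 := Subgroup.subset_closure (by simp)

theorem refl_mem : refl ∈ D4 := Subgroup.subset_closure (by simp)

theorem rel_rot (a : Fin 3 → ℂ) : orbitSetoid a ![-a 1, a 0, -a 2] :=
  ⟨rot, rot_mem, rot_mulVec a⟩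

theorem rel_refl (a : Fin 3 → ℂ) : orbitSetoid a ![a 0, -a 1, a 2] :=
  ⟨refl, refl_mem, refl_mulVec a⟩

/-- To respect orbits it suffices to respect the two generators. -/
theorem respects_of_generators {S : Setoid (Fin 3 → ℂ)}
    (hR : ∀ a, S a ![-a 1, a 0, -a 2]) (hC : ∀ a, S a ![a 0, -a 1, a 2]) {a b : Fin 3 → ℂ}
    (h : orbitSetoid a b) : S a b := by
  obtain ⟨A, hA, rfl⟩ := h
  induction hA using Subgroup.closure_induction generalizing a with
  | mem A hA =>
    rcases hA with rfl | rfl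
    · rw [rot_mulVec]
      exact hR a
    · rw [refl_mulVec]
      exact hC a
  | one => simp
  | mul A B _ _ hA hB =>
    rw [Units.val_mul, ← Matrix.mulVec_mulVec]
    exact S.trans hB hA
  | inv A _ hA =>
    have := @hA ((A⁻¹).val.mulVec a)
    rw [Matrix.mulVec_mulVec, ← Units.val_mul, mul_inv_cancel, Units.val_one,
      Matrix.one_mulVec] at this
    exact S.symm this

theorem F_eq_of_rel {a b : Fin 3 → ℂ} (h : orbitSetoid a b) : F a = F b := by
  refine respects_of_generators (S := Setoid.ker F) ?_ ?_ h
  · intro a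
    refine Setoid.ker_def.2 (Subtype.ext ?_)
    rw [F_val, F_val]
    funext j
    fin_cases j <;> simp <;> ring
  · intro a
    refine Setoid.ker_def.2 (Subtype.ext ?_)
    rw [F_val, F_val]
    funext j
    fin_cases j <;> simp

theorem rel_of_F_eq {a b : Fin 3 → ℂ} (h : F a = F b) : orbitSetoid a b := by
  have h' := congrArg Subtype.val h
  rw [F_val, F_val] at h'
  have h0 := congrFun h' 0
  have h1 := congrFun h' 1
  have h2 := congrFun h' 2
  have h3 := congrFun h' 3
  simp only [Matrix.cons_val] at h0 h1 h2 h3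
  -- points with the same `x²`, `y²` and `z` lie in the same orbit
  have key : ∀ c : Fin 3 → ℂ, c 0 ^ 2 = b 0 ^ 2 → c 1 ^ 2 = b 1 ^ 2 → c 2 = b 2 →
      orbitSetoid c b := by
    intro c e0 e1 e2
    have r1 := rel_refl c
    have r2 := orbitSetoid.trans (rel_rot c) (rel_rot _)
    have r3 := orbitSetoid.trans r2 (rel_refl _)
    simp only [Matrix.cons_val] at r1 r2 r3
    have hb : b = ![b 0, b 1, b 2] := by
      funext i
      fin_cases i <;> rfl
    rcases sq_eq_sq_iff_eq_or_eq_neg.1 e0 with e0 | e0 <;>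
      rcases sq_eq_sq_iff_eq_or_eq_neg.1 e1 with e1 | e1
    · have : c = b := by
        funext i
        fin_cases i <;> assumption
      rw [this]
    · rw [hb]
      simpa [e0, e1, e2] using r1
    · rw [hb]
      simpa [e0, e1, e2] using r3
    · rw [hb]
      simpa [e0, e1, e2] using r2
  have hsign : (a 2 = b 2 ∧ a 0 ^ 2 - a 1 ^ 2 = b 0 ^ 2 - b 1 ^ 2) ∨
      (a 2 = -b 2 ∧ a 0 ^ 2 - a 1 ^ 2 = -(b 0 ^ 2 - b 1 ^ 2)) := by
    rcases sq_eq_sq_iff_eq_or_eq_neg.1 h1 with e | e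
    · by_cases hz : b 2 = 0
      · rcases sq_eq_sq_iff_eq_or_eq_neg.1 h3 with e3 | e3
        · exact Or.inl ⟨e, e3⟩
        · exact Or.inr ⟨by rw [e, hz, neg_zero], e3⟩
      · left
        refine ⟨e, mul_left_cancel₀ hz ?_⟩
        rw [← h2, e]
    · by_cases hz : b 2 = 0
      · rcases sq_eq_sq_iff_eq_or_eq_neg.1 h3 with e3 | e3
        · exact Or.inl ⟨by rw [e, hz, neg_zero], e3⟩
        · exact Or.inr ⟨e, e3⟩
      · right
        refine ⟨e, mul_left_cancel₀ hz ?_⟩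
        rw [mul_neg, ← h2, e]
        ring
  rcases hsign with ⟨e, hu⟩ | ⟨e, hu⟩
  · exact key a (by linear_combination (h0 + hu) / 2) (by linear_combination (h0 - hu) / 2) e
  · refine orbitSetoid.trans (rel_rot a) (key _ ?_ ?_ ?_)
    · simp only [Matrix.cons_val]
      linear_combination (h0 - hu) / 2
    · simp only [Matrix.cons_val]
      linear_combination (h0 + hu) / 2
    · simp [e]

theorem F_surjective : Function.Surjective F := by
  rintro ⟨v, hv⟩
  have hv : v 2 ^ 2 - v 1 * v 3 = 0 := hv
  have hsq : ∀ w : ℂ, ∃ t, t ^ 2 = w := fun w => IsAlgClosed.exists_pow_nat_eq w two_pos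
  obtain ⟨z, u, hz, hzu, hu⟩ : ∃ z u : ℂ, z ^ 2 = v 1 ∧ z * u = v 2 ∧ u ^ 2 = v 3 := by
    obtain ⟨z, hz⟩ := hsq (v 1)
    by_cases h0 : z = 0
    · obtain ⟨u, hu⟩ := hsq (v 3)
      refine ⟨z, u, hz, ?_, hu⟩
      have : v 1 = 0 := by rw [← hz, h0]; simp
      rw [this] at hv
      have : v 2 = 0 := by simpa using hv
      rw [this, h0, zero_mul]
    · refine ⟨z, v 2 / z, hz, by field_simp, ?_⟩
      rw [div_pow, hz, div_eq_iff (by rw [← hz]; exact pow_ne_zero 2 h0)]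
      linear_combination hv
  obtain ⟨x, hx⟩ := hsq ((v 0 + u) / 2)
  obtain ⟨y, hy⟩ := hsq ((v 0 - u) / 2)
  refine ⟨![x, y, z], Subtype.ext ?_⟩
  rw [F_val]
  have hd : x ^ 2 - y ^ 2 = u := by rw [hx, hy]; ring
  funext j
  fin_cases j
  · simp [hx, hy]
    ring
  · simp [hz]
  · simp [hd, hzu]
  · simp [hd, hu]

/-- The bijection `ℂ³ / D₄ ≃ X_Q` induced by `F`. -/
noncomputable def orbitEquiv : OrbitSpace ≃ XQ :=
  Equiv.ofBijective (Quotient.lift F fun _ _ h => F_eq_of_rel h) (by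
    constructor
    · rintro ⟨a⟩ ⟨b⟩ h
      exact Quotient.sound (rel_of_F_eq h)
    · intro v
      obtain ⟨a, ha⟩ := F_surjective v
      exact ⟨Quotient.mk _ a, ha⟩)

/-! The map `f_d` sends orbits to orbits -/

/-- The first three elementary symmetric functions of `t_1, …, t_4`. -/
def Phi (t : Fin 4 → ℂ) : Fin 3 → ℂ :=
  ![t 0 + t 1 + t 2 + t 3,
    t 0 * t 1 + t 0 * t 2 + t 0 * t 3 + t 1 * t 2 + t 1 * t 3 + t 2 * t 3,
    t 0 * t 1 * t 2 + t 0 * t 1 * t 3 + t 0 * t 2 * t 3 + t 1 * t 2 * t 3]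

theorem aeval_esymm_castSucc (t : Fin 4 → ℂ) (j : Fin 3) :
    aeval t (esymm (Fin 4) ℤ (j + 1)) = Phi t j := by
  have h2 : Finset.powersetCard 2 (Finset.univ : Finset (Fin 4)) =
      {{0, 1}, {0, 2}, {0, 3}, {1, 2}, {1, 3}, {2, 3}} := by decide
  have h3 : Finset.powersetCard 3 (Finset.univ : Finset (Fin 4)) =
      {{0, 1, 2}, {0, 1, 3}, {0, 2, 3}, {1, 2, 3}} := by decide
  fin_cases j
  · have h := congrArg (aeval t) (esymm_one (Fin 4) ℤ)
    rw [Fin.sum_univ_four, map_add, map_add, map_add, aeval_X, aeval_X, aeval_X, aeval_X] at h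
    exact h
  · simp [esymm, h2, Phi]
    rw [Finset.sum_insert (by decide), Finset.sum_insert (by decide),
      Finset.sum_insert (by decide), Finset.sum_insert (by decide),
      Finset.sum_insert (by decide)]
    simp
    ring
  · simp [esymm, h3, Phi]
    rw [Finset.sum_insert (by decide), Finset.sum_insert (by decide),
      Finset.sum_insert (by decide)]
    simp
    ring

theorem aeval_zPoly (d : ℕ) (t : Fin 4 → ℂ) (ht : t 0 * t 1 * t 2 * t 3 = 1) (j : Fin 3) :
    aeval (Phi t) (zPoly 3 d j) = Phi (fun i => t i ^ d) j := by
  set P := (esymmAlgEquiv (σ := Fin (3 + 1)) ℤ (Fintype.card_fin (3 + 1))).symm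
      ⟨expand d (esymm (Fin (3 + 1)) ℤ (j + 1)), fun e => by
        rw [rename_expand, (esymm_isSymmetric (Fin (3 + 1)) ℤ (j + 1)) e]⟩ with hP
  have h1 : aeval (fun i : Fin (3 + 1) => esymm (Fin (3 + 1)) ℤ (i + 1)) P =
      expand d (esymm (Fin (3 + 1)) ℤ (j + 1)) := by
    have h := congrArg Subtype.val
      ((esymmAlgEquiv (σ := Fin (3 + 1)) ℤ (Fintype.card_fin (3 + 1))).apply_symm_apply
        ⟨expand d (esymm (Fin (3 + 1)) ℤ (j + 1)), fun e => by
          rw [rename_expand, (esymm_isSymmetric (Fin (3 + 1)) ℤ (j + 1)) e]⟩)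
    rw [← hP, esymmAlgEquiv_apply, esymmAlgHom_apply] at h
    exact h
  have h2 := congrArg (aeval t) h1
  have h3 : aeval t (expand d (esymm (Fin (3 + 1)) ℤ (j + 1))) =
      aeval (fun i => t i ^ d) (esymm (Fin (3 + 1)) ℤ (j + 1)) := by
    rw [expand, aeval_bind₁]
    simp
  rw [h3, aeval_esymm_castSucc, ← AlgHom.comp_apply, comp_aeval] at h2
  rw [← h2, zPoly, aeval_bind₁]
  refine congrFun (congrArg DFunLike.coe (congrArg aeval (funext fun i => ?_))) P
  refine Fin.lastCases ?_ (fun i => ?_) i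
  · have h4 : Finset.powersetCard 4 (Finset.univ : Finset (Fin 4)) = {Finset.univ} := by decide
    rw [Fin.snoc_last, map_one]
    simp [esymm, h4, Fin.prod_univ_four, ht]
  · rw [Fin.snoc_castSucc, aeval_X]
    exact (aeval_esymm_castSucc t i).symm

theorem exists_Phi (z : Fin 3 → ℂ) :
    ∃ t : Fin 4 → ℂ, t 0 * t 1 * t 2 * t 3 = 1 ∧ Phi t = z := by
  set p : Polynomial ℂ := Polynomial.X ^ 4 - Polynomial.C (z 0) * Polynomial.X ^ 3 +
    Polynomial.C (z 1) * Polynomial.X ^ 2 - Polynomial.C (z 2) * Polynomial.X + 1 with hp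
  have hdeg : p.natDegree = 4 := by rw [hp]; compute_degree!
  have hmon : p.Monic := by rw [hp]; monicity!
  have hcard : Multiset.card p.roots = 4 := by
    rw [← hdeg]
    exact IsAlgClosed.card_roots_eq_natDegree
  have hprod : (p.roots.map fun a => Polynomial.X - Polynomial.C a).prod = p :=
    Polynomial.prod_multiset_X_sub_C_of_monic_of_roots_card_eq hmon (hcard.trans hdeg.symm)
  obtain ⟨l, hl⟩ := Quot.exists_rep p.roots
  have hl : (l : Multiset ℂ) = p.roots := hl
  rw [← hl] at hcard hprod
  obtain ⟨a, b, c, e, rfl⟩ : ∃ a b c e, l = [a, b, c, e] := by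
    rw [Multiset.coe_card] at hcard
    match l, hcard with
    | [a, b, c, e], _ => exact ⟨a, b, c, e, rfl⟩
  have hev : ∀ w : ℂ, (w - a) * ((w - b) * ((w - c) * (w - e))) =
      w ^ 4 - z 0 * w ^ 3 + z 1 * w ^ 2 - z 2 * w + 1 := by
    intro w
    have h := congrArg (Polynomial.eval w) hprod
    simpa [hp] using h
  have e0 := hev 0
  have e1 := hev 1
  have e2 := hev (-1)
  have e3 := hev 2
  refine ⟨![a, b, c, e], ?_, ?_⟩
  · simp
    linear_combination e0
  · funext i
    fin_cases i
    · simp [Phi]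
      linear_combination (-1 / 6) * e3 + (1 / 2) * e1 + (1 / 6) * e2 - (1 / 2) * e0
    · simp [Phi]
      linear_combination (1 / 2) * e1 + (1 / 2) * e2 - e0
    · simp [Phi]
      linear_combination (1 / 6) * e3 - e1 + (1 / 3) * e2 + (1 / 2) * e0

/-- `T_d(Phi(t)) = Phi(t ^ d)`. -/
theorem chebyshev_Phi (d : ℕ) (t : Fin 4 → ℂ) (ht : t 0 * t 1 * t 2 * t 3 = 1) :
    chebyshev 3 d (Phi t) = Phi fun i => t i ^ d := by
  funext j
  simp only [chebyshev, Int.natCast_nonneg, if_true, Int.natAbs_natCast]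
  exact aeval_zPoly d t ht j

theorem chebyshev_rot (d : ℕ) (z : Fin 3 → ℂ) :
    chebyshev 3 d ![Complex.I * z 0, -z 1, -(Complex.I * z 2)] =
      ![Complex.I ^ d * chebyshev 3 d z 0, (-1) ^ d * chebyshev 3 d z 1,
        (-Complex.I) ^ d * chebyshev 3 d z 2] := by
  have hI := Complex.I_mul_I
  obtain ⟨t, ht, rfl⟩ := exists_Phi z
  have h1 : (![Complex.I * Phi t 0, -Phi t 1, -(Complex.I * Phi t 2)] : Fin 3 → ℂ) =
      Phi fun i => Complex.I * t i := by
    funext i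
    fin_cases i
    · simp [Phi]
      ring
    · simp [Phi]
      linear_combination (-(t 0 * t 1 + t 0 * t 2 + t 0 * t 3 + t 1 * t 2 + t 1 * t 3 +
        t 2 * t 3)) * hI
    · simp [Phi]
      linear_combination (-Complex.I * (t 0 * t 1 * t 2 + t 0 * t 1 * t 3 + t 0 * t 2 * t 3 +
        t 1 * t 2 * t 3)) * hI
  rw [h1, chebyshev_Phi d t ht, chebyshev_Phi d]
  · have e2 : (-1 : ℂ) ^ d = (Complex.I ^ d) ^ 2 := by
      rw [← pow_mul, mul_comm, pow_mul, Complex.I_sq]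
    have e3 : (-Complex.I) ^ d = (Complex.I ^ d) ^ 3 := by
      rw [← pow_mul, mul_comm, pow_mul, Complex.I_pow_three]
    rw [e2, e3]
    funext i
    fin_cases i <;> simp [Phi, mul_pow] <;> ring
  · linear_combination Complex.I ^ 4 * ht + Complex.I_pow_four

theorem chebyshev_rev (d : ℕ) (z : Fin 3 → ℂ) :
    chebyshev 3 d ![z 2, z 1, z 0] =
      ![chebyshev 3 d z 2, chebyshev 3 d z 1, chebyshev 3 d z 0] := by
  obtain ⟨t, ht, rfl⟩ := exists_Phi z
  -- replace each `t i` by its inverse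
  have key : ∀ u : Fin 4 → ℂ, u 0 * u 1 * u 2 * u 3 = 1 →
      Phi (fun i => (u i)⁻¹) = ![Phi u 2, Phi u 1, Phi u 0] := by
    intro u hu
    have i0 : (u 0)⁻¹ = u 1 * u 2 * u 3 := inv_eq_of_mul_eq_one_right (by
      linear_combination hu)
    have i1 : (u 1)⁻¹ = u 0 * u 2 * u 3 := inv_eq_of_mul_eq_one_right (by
      linear_combination hu)
    have i2 : (u 2)⁻¹ = u 0 * u 1 * u 3 := inv_eq_of_mul_eq_one_right (by
      linear_combination hu)
    have i3 : (u 3)⁻¹ = u 0 * u 1 * u 2 := inv_eq_of_mul_eq_one_right (by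
      linear_combination hu)
    funext i
    fin_cases i
    · simp [Phi, i0, i1, i2, i3]
      ring
    · simp [Phi, i0, i1, i2, i3]
      linear_combination (u 0 * u 1 + u 0 * u 2 + u 0 * u 3 + u 1 * u 2 + u 1 * u 3 +
        u 2 * u 3) * hu
    · simp [Phi, i0, i1, i2, i3]
      linear_combination (u 0 + u 1 + u 2 + u 3) * (u 0 * u 1 * u 2 * u 3 + 1) * hu
  have hinv : (fun i => (t i)⁻¹) 0 * (fun i => (t i)⁻¹) 1 * (fun i => (t i)⁻¹) 2 *
      (fun i => (t i)⁻¹) 3 = 1 := by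
    simp only [← mul_inv, ht, inv_one]
  have hpow : t 0 ^ d * t 1 ^ d * t 2 ^ d * t 3 ^ d = 1 := by
    rw [← mul_pow, ← mul_pow, ← mul_pow, ht, one_pow]
  have h2 := key (fun i => t i ^ d) hpow
  simp only [← inv_pow] at h2
  rw [← key t ht, chebyshev_Phi d (fun i => (t i)⁻¹) hinv, chebyshev_Phi d t ht, ← h2]

theorem f_rot (d : ℕ) (a : Fin 3 → ℂ) :
    orbitSetoid (f d a) (f d ![-a 1, a 0, -a 2]) := by
  have h : f d ![-a 1, a 0, -a 2] = coord.symm ![Complex.I ^ d * chebyshev 3 d (coord a) 0,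
      (-1) ^ d * chebyshev 3 d (coord a) 1, (-Complex.I) ^ d * chebyshev 3 d (coord a) 2] := by
    rw [← chebyshev_rot, f]
    congr 2
    funext i
    fin_cases i
    · simp [coord]
      linear_combination (-a 1) * Complex.I_mul_I
    · simp [coord]
    · simp [coord]
      linear_combination (-a 1) * Complex.I_mul_I
  rw [h, f]
  clear h
  generalize chebyshev 3 d (coord a) = w
  -- `R ^ d` in the two coordinate systems
  induction d with
  | zero =>
    have : (![w 0, w 1, w 2] : Fin 3 → ℂ) = w := by
      funext i
      fin_cases i <;> rfl
    simp [this]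
  | succ d ih =>
    refine orbitSetoid.trans ih ?_
    convert rel_rot _ using 1
    have hI := Complex.I_ne_zero
    have hI2 := Complex.I_sq
    funext i
    fin_cases i
    · simp [coord]
      field_simp
      simp only [pow_succ]
      ring_nf
      rw [hI2]
      ring
    · simp [coord]
      field_simp
      ring
    · simp [coord]
      ring

theorem f_refl (d : ℕ) (a : Fin 3 → ℂ) :
    orbitSetoid (f d a) (f d ![a 0, -a 1, a 2]) := by
  have h : f d ![a 0, -a 1, a 2] = ![f d a 0, -f d a 1, f d a 2] := by
    have h1 : coord ![a 0, -a 1, a 2] = ![coord a 2, coord a 1, coord a 0] := by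
      funext i
      fin_cases i <;> simp [coord, sub_eq_add_neg]
    rw [f, h1, chebyshev_rev, f]
    funext i
    fin_cases i
    · simp [coord]
      ring
    · simp [coord]
      ring
    · simp [coord]
  rw [h]
  exact rel_refl _

theorem f_neg (d : ℕ) (hd : d ≠ 0) (a : Fin 3 → ℂ) : f (-d) a = f d ![a 0, -a 1, a 2] := by
  have h1 : coord ![a 0, -a 1, a 2] = coord a ∘ Fin.rev := by
    funext i
    fin_cases i <;> simp [coord, sub_eq_add_neg, Fin.rev]
  have h3 : chebyshev 3 (-d) (coord a) = chebyshev 3 d (coord a ∘ Fin.rev) := by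
    funext j
    simp [chebyshev, hd]
  rw [f, f, h1, h3]

theorem f_rel (d : ℤ) {a b : Fin 3 → ℂ} (h : orbitSetoid a b) : orbitSetoid (f d a) (f d b) := by
  have hnat : ∀ (n : ℕ) {a b : Fin 3 → ℂ}, orbitSetoid a b → orbitSetoid (f n a) (f n b) :=
    fun n a b h => respects_of_generators (S := orbitSetoid.comap (f n)) (f_rot n) (f_refl n) h
  obtain ⟨n, rfl | rfl⟩ := d.eq_nat_or_neg
  · exact hnat n h
  · rcases eq_or_ne n 0 with rfl | hn
    · exact hnat 0 h
    rw [f_neg n hn, f_neg n hn]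
    exact hnat n (orbitSetoid.trans (orbitSetoid.symm (rel_refl a))
      (orbitSetoid.trans h (rel_refl b)))

/-! The induced morphisms `g_d` -/

/-- The map induced by `f_d` on the orbit space `ℂ³ / D₄`. -/
noncomputable def orbitMap (d : ℤ) : OrbitSpace → OrbitSpace :=
  Quotient.map (f d) fun _ _ h => f_rel d h

/-- The map `g_d : X_Q → X_Q` induced by `f_d` through the identification `ℂ³ / D₄ ≃ X_Q`;
it is the unique map with `g_d ∘ F = F ∘ f_d`. -/
noncomputable def g (d : ℤ) (v : XQ) : XQ := orbitEquiv (orbitMap d (orbitEquiv.symm v))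

theorem g_F (d : ℤ) (a : Fin 3 → ℂ) : g d (F a) = F (f d a) := by
  have h : orbitEquiv.symm (F a) = Quotient.mk orbitSetoid a :=
    (Equiv.symm_apply_eq _).2 rfl
  rw [g, h]
  rfl

/-- A map `φ : V → W` of subsets of affine spaces over `ℂ` is a morphism defined over the
subring `k` if its components are the restrictions of polynomials with coefficients in `k`. -/
def IsMorphismOver (k : Type*) [CommRing k] [Algebra k ℂ] {m n : ℕ} {V : Set (Fin m → ℂ)}
    {W : Set (Fin n → ℂ)} (φ : V → W) : Prop :=
  ∃ P : Fin n → MvPolynomial (Fin m) k, ∀ (v : V) (j : Fin n), (φ v).1 j = aeval v.1 (P j)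

end ChebyshevDihedral

/-!
In the coordinates `z = coord a` the invariants are
`p = z₁ z₃`, `q = z₂²`, `r = z₂ u`, `s = u²` with `u = (z₁² + z₃²) / 2`, so the only obstruction to
integrality is the denominator in `u`.

Let `Z₁, Z₂, Z₃ ∈ ℤ[z₁, z₂, z₃]` be the components of `T_d`. Give `z_j` the weight `j` modulo `4`.
The equivariance of `T_d` under the rotation says that `Z_j` is homogeneous of weight `d j`
(`zPoly_isWeightedHomogeneous`), and its equivariance under the reflection says that the involution
`σ` exchanging `z₁` and `z₃` maps `Z₁, Z₂, Z₃` to `Z₃, Z₂, Z₁`.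

The key fact is `exists_half_trace`: if `A ∈ ℤ[z₁, z₂, z₃]` is homogeneous of even weight `2 e`, then
`(A + σ A) / 2` is a polynomial with *integer* coefficients in `p, z₂, u`, of weight `e` modulo `2`
when `z₂` and `u` have weight `1`. It is enough to see this for monomials, where up to a factor
`p ^ c * z₂ ^ b` one meets `(z₁ ^ (2 l) + z₃ ^ (2 l)) / 2`, a Chebyshev polynomial in `u` and `p²`.
An integer polynomial in `p, z₂, u` of weight `0` is one in `p, q, r, s`.

Half the trace of a `σ`-invariant polynomial is the polynomial itself. Hence the key fact applies to
`Z₁ Z₃`, to `Z₂²`, to `Z₂ Z₁²`, whose half trace is `r ∘ f_d`, and to `Z₁²`, the square of whose half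
trace is `s ∘ f_d`. Finally `g_{-d} = g_d`, as `f_{-d}` is `f_d` composed with an element of `D₄`.
-/

namespace ChebyshevDihedral

open MvPolynomial

/-! ### Weights modulo four -/

/-- The weights modulo `4` of the coordinates `z_1, z_2, z_3`: the rotation in `D₄` multiplies `z_j`
by `i ^ j`. -/
def zWeight : Fin 3 → ZMod 4 := ![1, 2, 3]

/-- The weights modulo `2` of the functions `p`, `z_2` and `u = (z_1² + z_3²) / 2`. -/
def puWeight : Fin 3 → ZMod 2 := ![0, 1, 1]

theorem weight_fin_three {M : Type*} [AddCommMonoid M] (w : Fin 3 → M) (m : Fin 3 →₀ ℕ) :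
    Finsupp.weight w m = m 0 • w 0 + m 1 • w 1 + m 2 • w 2 := by
  rw [Finsupp.weight_apply, Finsupp.sum_fintype _ _ (by simp), Fin.sum_univ_three]

theorem coeff_aeval_C_mul_X {σ R : Type*} [CommRing R] (c : σ → R) (A : MvPolynomial σ R)
    (m : σ →₀ ℕ) :
    coeff m (aeval (fun i => C (c i) * X i) A) = (m.prod fun i k => c i ^ k) * coeff m A := by
  classical
  induction A using MvPolynomial.induction_on' with
  | add p q hp hq => rw [map_add, coeff_add, coeff_add, hp, hq, mul_add]
  | monomial n r =>
    have h : aeval (fun i => C (c i) * X i) (monomial n r) =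
        monomial n ((n.prod fun i k => c i ^ k) * r) := by
      rw [aeval_monomial, monomial_eq, C_mul, algebraMap_eq]
      simp only [mul_pow, Finsupp.prod, Finset.prod_mul_distrib, map_prod, map_pow]
      ring
    rw [h, coeff_monomial, coeff_monomial]
    split_ifs with e
    · rw [e]
    · rw [mul_zero]

theorem I_pow_eq_iff (a b : ℕ) : Complex.I ^ a = Complex.I ^ b ↔ (a : ZMod 4) = b := by
  have h := Complex.isPrimitiveRoot_I
  rw [ZMod.natCast_eq_natCast_iff, h.eq_orderOf]
  exact (h.isOfFinOrder (by norm_num)).pow_eq_pow_iff_modEq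

/-- A polynomial that the rotation multiplies by `i ^ n` is homogeneous of weight `n`. -/
theorem isWeightedHomogeneous_of_rot {A : MvPolynomial (Fin 3) ℤ} {n : ℕ}
    (h : ∀ z : Fin 3 → ℂ, aeval ![Complex.I * z 0, -z 1, -(Complex.I * z 2)] A =
      Complex.I ^ n * aeval z A) :
    IsWeightedHomogeneous zWeight A (n : ZMod 4) := by
  intro m hm
  set c : Fin 3 → ℂ := ![Complex.I, Complex.I ^ 2, Complex.I ^ 3] with hc
  have hpoly : aeval (fun i => C (c i) * X i) (map (algebraMap ℤ ℂ) A) =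
      C (Complex.I ^ n) * map (algebraMap ℤ ℂ) A := by
    refine MvPolynomial.funext fun z => ?_
    have hz : (fun i => aeval z (C (c i) * X i)) =
        ![Complex.I * z 0, -z 1, -(Complex.I * z 2)] := by
      funext i
      fin_cases i <;> simp [hc, Complex.I_pow_three]
    rw [← aeval_eq_eval, aeval_eq_bind₁, aeval_bind₁, hz, map_mul, aeval_C, aeval_map_algebraMap,
      aeval_map_algebraMap, h z, Algebra.algebraMap_self_apply]
  have hcoeff := congrArg (coeff m) hpoly
  rw [coeff_aeval_C_mul_X, coeff_C_mul, coeff_map,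
    Finsupp.prod_fintype _ _ (by simp), Fin.prod_univ_three] at hcoeff
  have hne : algebraMap ℤ ℂ (coeff m A) ≠ 0 := by simpa using hm
  have hpow := mul_right_cancel₀ hne hcoeff
  simp only [hc, Matrix.cons_val, ← pow_mul, ← pow_add] at hpow
  have := (I_pow_eq_iff _ _).1 hpow
  rw [weight_fin_three, ← this]
  simp [zWeight]
  ring

theorem aeval_zPoly_eq_chebyshev (n : ℕ) (z : Fin 3 → ℂ) (j : Fin 3) :
    aeval z (zPoly 3 n j) = chebyshev 3 n z j := by
  simp [chebyshev]

theorem zPoly_isWeightedHomogeneous (n : ℕ) (j : Fin 3) :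
    IsWeightedHomogeneous zWeight (zPoly 3 n j) ((((j : ℕ) + 1) * n : ℕ) : ZMod 4) := by
  refine isWeightedHomogeneous_of_rot fun z => ?_
  rw [aeval_zPoly_eq_chebyshev, aeval_zPoly_eq_chebyshev, chebyshev_rot, pow_mul]
  fin_cases j
  · simp
  · simp
  · simp [Complex.I_pow_three]

theorem aeval_zPoly_rev (n : ℕ) (z : Fin 3 → ℂ) (j : Fin 3) :
    aeval ![z 2, z 1, z 0] (zPoly 3 n j) = aeval z (zPoly 3 n j.rev) := by
  rw [aeval_zPoly_eq_chebyshev, aeval_zPoly_eq_chebyshev, chebyshev_rev]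
  fin_cases j <;> rfl

/-! ### Half traces -/

/-- The functions `p`, `z_2` and `u = (z_1² + z_3²) / 2` of the coordinates `z_1, z_2, z_3`. -/
noncomputable def pu (z : Fin 3 → ℂ) : Fin 3 → ℂ :=
  ![z 0 * z 2, z 1, (z 0 ^ 2 + z 2 ^ 2) / 2]

theorem isWeightedHomogeneous_puWeight_monomial (a b c : ℕ) :
    IsWeightedHomogeneous puWeight (X 0 ^ a * X 1 ^ b * X 2 ^ c : MvPolynomial (Fin 3) ℤ)
      ((b + c : ℕ) : ZMod 2) := by
  have h := (((isWeightedHomogeneous_X ℤ puWeight 0).pow a).mul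
    ((isWeightedHomogeneous_X ℤ puWeight 1).pow b)).mul
    ((isWeightedHomogeneous_X ℤ puWeight 2).pow c)
  convert h using 1
  simp [puWeight]

/-- Half the power sum `α ^ l + β ^ l` of `α = z_1²`, `β = z_3²` is a polynomial in
`u = (α + β) / 2` and `p² = α β`, a homogenized Chebyshev polynomial of the first kind. -/
theorem exists_half_power_sum (l : ℕ) : ∃ B : MvPolynomial (Fin 3) ℤ,
    IsWeightedHomogeneous puWeight B (l : ZMod 2) ∧
      ∀ z : Fin 3 → ℂ, z 0 ^ (2 * l) + z 2 ^ (2 * l) = 2 * aeval (pu z) B := by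
  induction l using Nat.twoStepInduction with
  | zero =>
    refine ⟨1, by simpa using isWeightedHomogeneous_one ℤ puWeight, fun z => ?_⟩
    simp
    norm_num
  | one =>
    refine ⟨X 2, by simpa [puWeight] using isWeightedHomogeneous_X ℤ puWeight 2, fun z => ?_⟩
    simp [pu]
    ring
  | more l h1 h2 =>
    obtain ⟨B, hB, eB⟩ := h1
    obtain ⟨B', hB', eB'⟩ := h2
    refine ⟨C 2 * (X 2 * B') - X 0 ^ 2 * B, ?_, fun z => ?_⟩
    · have e1 := (isWeightedHomogeneous_C puWeight (2 : ℤ)).mul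
        ((isWeightedHomogeneous_X ℤ puWeight 2).mul hB')
      have e2 := ((isWeightedHomogeneous_X ℤ puWeight 0).pow 2).mul hB
      have w2 : ((l + 2 : ℕ) : ZMod 2) = l := by
        rw [Nat.cast_add, ZMod.natCast_self, add_zero]
      rw [w2]
      refine (weightedHomogeneousSubmodule ℤ puWeight (l : ZMod 2)).sub_mem ?_ ?_
      · rw [mem_weightedHomogeneousSubmodule]
        convert e1 using 1
        rw [← w2]
        simp [puWeight]
        ring
      · rw [mem_weightedHomogeneousSubmodule]
        convert e2 using 1
        simp [puWeight]
    · have hp : pu z 0 = z 0 * z 2 := rfl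
      have hu : pu z 2 = (z 0 ^ 2 + z 2 ^ 2) / 2 := rfl
      simp only [map_sub, map_mul, map_pow, aeval_X, aeval_C, hp, hu]
      have : algebraMap ℤ ℂ 2 = 2 := by simp
      rw [this]
      linear_combination (-(z 0 * z 2) ^ 2) * eB z + (z 0 ^ 2 + z 2 ^ 2) * eB' z

theorem exists_half_trace_monomial {a b c e : ℕ}
    (h : ((a + 2 * b + 3 * c : ℕ) : ZMod 4) = ((2 * e : ℕ) : ZMod 4)) :
    ∃ B : MvPolynomial (Fin 3) ℤ, IsWeightedHomogeneous puWeight B (e : ZMod 2) ∧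
      ∀ z : Fin 3 → ℂ, z 0 ^ a * z 1 ^ b * z 2 ^ c + z 2 ^ a * z 1 ^ b * z 0 ^ c =
        2 * aeval (pu z) B := by
  wlog hac : c ≤ a generalizing a c
  · obtain ⟨B, hB, eB⟩ := this (a := c) (c := a) (by
      rw [ZMod.natCast_eq_natCast_iff'] at h ⊢
      omega) (by omega)
    exact ⟨B, hB, fun z => by rw [← eB]; ring⟩
  rw [ZMod.natCast_eq_natCast_iff'] at h
  obtain ⟨l, rfl⟩ : ∃ l, a = c + 2 * l := ⟨(a - c) / 2, by omega⟩
  obtain ⟨B, hB, eB⟩ := exists_half_power_sum l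
  refine ⟨X 0 ^ c * X 1 ^ b * X 2 ^ 0 * B, ?_, fun z => ?_⟩
  · convert (isWeightedHomogeneous_puWeight_monomial c b 0).mul hB using 1
    rw [← Nat.cast_add, ZMod.natCast_eq_natCast_iff']
    omega
  · have hp : pu z 0 = z 0 * z 2 := rfl
    have hz : pu z 1 = z 1 := rfl
    simp only [map_mul, map_pow, aeval_X, hp, hz]
    linear_combination (z 0 * z 2) ^ c * z 1 ^ b * eB z

/-- The half trace, under the exchange of `z_1` and `z_3`, of an integer polynomial of even weight
is an integer polynomial in `p`, `z_2` and `u`. -/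
theorem exists_half_trace {A : MvPolynomial (Fin 3) ℤ} {e : ℕ}
    (hA : IsWeightedHomogeneous zWeight A ((2 * e : ℕ) : ZMod 4)) :
    ∃ B : MvPolynomial (Fin 3) ℤ, IsWeightedHomogeneous puWeight B (e : ZMod 2) ∧
      ∀ z : Fin 3 → ℂ, aeval z A + aeval ![z 2, z 1, z 0] A = 2 * aeval (pu z) B := by
  have hmon : ∀ m : Fin 3 →₀ ℕ, ∃ B : MvPolynomial (Fin 3) ℤ, m ∈ A.support →
      IsWeightedHomogeneous puWeight B (e : ZMod 2) ∧
      ∀ z : Fin 3 → ℂ, z 0 ^ m 0 * z 1 ^ m 1 * z 2 ^ m 2 + z 2 ^ m 0 * z 1 ^ m 1 * z 0 ^ m 2 =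
        2 * aeval (pu z) B := by
    intro m
    by_cases hm : m ∈ A.support
    · have hw := hA (mem_support_iff.1 hm)
      rw [weight_fin_three] at hw
      obtain ⟨B, hB⟩ := exists_half_trace_monomial (a := m 0) (b := m 1) (c := m 2) (e := e) (by
        rw [← hw]
        simp [zWeight]
        ring)
      exact ⟨B, fun _ => hB⟩
    · exact ⟨0, fun h => absurd h hm⟩
  choose B hB using hmon
  refine ⟨∑ m ∈ A.support, C (coeff m A) * B m, ?_, fun z => ?_⟩
  · refine (weightedHomogeneousSubmodule ℤ puWeight (e : ZMod 2)).sum_mem fun m hm => ?_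
    rw [C_mul']
    exact Submodule.smul_mem _ _ (hB m hm).1
  · have hev : ∀ y : Fin 3 → ℂ, aeval y A =
        ∑ m ∈ A.support, ((coeff m A : ℤ) : ℂ) * (y 0 ^ m 0 * y 1 ^ m 1 * y 2 ^ m 2) := by
      intro y
      rw [aeval_def, eval₂_eq']
      simp only [Fin.prod_univ_three, eq_intCast]
    rw [hev, hev, ← Finset.sum_add_distrib, map_sum, Finset.mul_sum]
    refine Finset.sum_congr rfl fun m hm => ?_
    rw [map_mul, aeval_C, eq_intCast]
    simp only [Matrix.cons_val]
    linear_combination ((coeff m A : ℤ) : ℂ) * (hB m hm).2 z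

/-! ### The invariants in the coordinates `z` -/

/-- The invariants `p`, `q = z_2²`, `r = z_2 u`, `s = u²` in terms of `z_1, z_2, z_3`. -/
noncomputable def zInvariants (z : Fin 3 → ℂ) : Fin 4 → ℂ :=
  ![z 0 * z 2, z 1 ^ 2, z 1 * ((z 0 ^ 2 + z 2 ^ 2) / 2), ((z 0 ^ 2 + z 2 ^ 2) / 2) ^ 2]

theorem F_coord_symm (z : Fin 3 → ℂ) : (F (coord.symm z)).1 = zInvariants z := by
  have hp : ((z 0 + z 2) / 2) ^ 2 + ((z 0 - z 2) / (2 * Complex.I)) ^ 2 = z 0 * z 2 := by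
    rw [div_pow (z 0 - z 2), mul_pow, Complex.I_sq]
    ring
  have hu : ((z 0 + z 2) / 2) ^ 2 - ((z 0 - z 2) / (2 * Complex.I)) ^ 2 =
      (z 0 ^ 2 + z 2 ^ 2) / 2 := by
    rw [div_pow (z 0 - z 2), mul_pow, Complex.I_sq]
    ring
  have h0 : coord.symm z 0 = (z 0 + z 2) / 2 := rfl
  have h1 : coord.symm z 1 = (z 0 - z 2) / (2 * Complex.I) := rfl
  have h2 : coord.symm z 2 = z 1 := rfl
  rw [F_val, h0, h1, h2, hp, hu, zInvariants]

/-- An integer polynomial in `p`, `z_2`, `u` of even weight in `z_2` and `u` is one in `p`,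
`q = z_2²`, `r = z_2 u` and `s = u²`. -/
theorem exists_aeval_zInvariants_eq {B : MvPolynomial (Fin 3) ℤ}
    (hB : IsWeightedHomogeneous puWeight B 0) :
    ∃ P : MvPolynomial (Fin 4) ℤ, ∀ z, aeval (pu z) B = aeval (zInvariants z) P := by
  -- `z_2` and `u` are paired off; if their exponents are odd, one factor `r` is left over
  refine ⟨∑ m ∈ B.support, C (coeff m B) *
    (X 0 ^ m 0 * X 1 ^ (m 1 / 2) * X 2 ^ (m 1 % 2) * X 3 ^ (m 2 / 2)), fun z => ?_⟩
  rw [aeval_def, eval₂_eq', map_sum]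
  refine Finset.sum_congr rfl fun m hm => ?_
  have hw := hB (mem_support_iff.1 hm)
  rw [weight_fin_three] at hw
  have hpar : m 1 % 2 = m 2 % 2 := by
    have h2 : ((m 1 + m 2 : ℕ) : ZMod 2) = (0 : ℕ) := by simpa [puWeight] using hw
    rw [ZMod.natCast_eq_natCast_iff'] at h2
    omega
  simp only [Fin.prod_univ_three, map_mul, map_pow, aeval_X, aeval_C, pu, zInvariants,
    Matrix.cons_val]
  generalize (z 0 ^ 2 + z 2 ^ 2) / 2 = u
  have e1 : z 1 ^ m 1 = (z 1 ^ 2) ^ (m 1 / 2) * z 1 ^ (m 1 % 2) := by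
    rw [← pow_mul, ← pow_add, Nat.div_add_mod]
  have e2 : u ^ m 2 = (u ^ 2) ^ (m 2 / 2) * u ^ (m 1 % 2) := by
    rw [hpar, ← pow_mul, ← pow_add, Nat.div_add_mod]
  rw [e1, e2]
  ring

/-! ### The induced morphisms -/

theorem g_neg (d : ℕ) : g (-d) = g d := by
  rcases eq_or_ne d 0 with rfl | hd
  · simp
  funext v
  obtain ⟨a, rfl⟩ := F_surjective v
  rw [g_F, f_neg d hd, ← g_F, ← F_eq_of_rel (rel_refl a)]

theorem exists_half_trace_of_weight_zero {A : MvPolynomial (Fin 3) ℤ}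
    (hA : IsWeightedHomogeneous zWeight A 0) :
    ∃ P : MvPolynomial (Fin 4) ℤ, ∀ z : Fin 3 → ℂ,
      aeval z A + aeval ![z 2, z 1, z 0] A = 2 * aeval (zInvariants z) P := by
  obtain ⟨B, hB, eB⟩ := exists_half_trace (A := A) (e := 0) (by simpa using hA)
  obtain ⟨P, hP⟩ := exists_aeval_zInvariants_eq (by simpa using hB)
  exact ⟨P, fun z => by rw [eB, hP]⟩

theorem isMorphismOver_g_natCast (n : ℕ) : IsMorphismOver ℤ (g n) := by
  have w := zPoly_isWeightedHomogeneous n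
  have hrev := aeval_zPoly_rev n
  have h4 : (4 : ZMod 4) = 0 := rfl
  obtain ⟨P₀, h₀⟩ := exists_half_trace_of_weight_zero (A := zPoly 3 n 0 * zPoly 3 n 2) (by
    convert (w 0).mul (w 2) using 1
    simp
    linear_combination (-n : ZMod 4) * h4)
  obtain ⟨P₁, h₁⟩ := exists_half_trace_of_weight_zero (A := zPoly 3 n 1 ^ 2) (by
    convert (w 1).pow 2 using 1
    simp
    linear_combination (-n : ZMod 4) * h4)
  obtain ⟨P₂, h₂⟩ := exists_half_trace_of_weight_zero (A := zPoly 3 n 1 * zPoly 3 n 0 ^ 2) (by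
    convert (w 1).mul ((w 0).pow 2) using 1
    simp
    linear_combination (-n : ZMod 4) * h4)
  -- `u ∘ f_n` may have odd weight, but its square has weight `0`
  obtain ⟨B, hB, eB⟩ := exists_half_trace (A := zPoly 3 n 0 ^ 2) (e := n) (by
    convert (w 0).pow 2 using 1
    simp)
  obtain ⟨P₃, h₃⟩ := exists_aeval_zInvariants_eq (B := B ^ 2) (by
    convert hB.pow 2 using 1
    rw [two_nsmul, CharTwo.add_self_eq_zero])
  refine ⟨![P₀, P₁, P₂, P₃], fun v j => ?_⟩
  obtain ⟨a, rfl⟩ := F_surjective v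
  obtain ⟨z, rfl⟩ := coord.symm.surjective a
  have hF : (g n (F (coord.symm z))).1 = zInvariants fun j => aeval z (zPoly 3 n j) := by
    rw [g_F, f, F_coord_symm, Equiv.apply_symm_apply]
    exact congrArg zInvariants (funext fun j => (aeval_zPoly_eq_chebyshev n z j).symm)
  rw [hF, F_coord_symm]
  have e0 := h₀ z
  have e1 := h₁ z
  have e2 := h₂ z
  have e3 := eB z
  have e4 := h₃ z
  have r0 : (0 : Fin 3).rev = 2 := rfl
  have r1 : (1 : Fin 3).rev = 1 := rfl
  have r2 : (2 : Fin 3).rev = 0 := rfl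
  simp only [map_mul, map_pow, hrev, r0, r1, r2] at e0 e1 e2 e3 e4
  -- `p ∘ f_n` and `q ∘ f_n` are invariant, so each is its own half trace
  fin_cases j
  · simp [zInvariants] at e0 ⊢
    linear_combination e0 / 2
  · simp [zInvariants] at e1 ⊢
    linear_combination e1 / 2
  · simp [zInvariants] at e2 ⊢
    linear_combination e2 / 2
  · simp only [Fin.reduceFinMk, Matrix.cons_val]
    rw [← e4]
    simp only [zInvariants, Matrix.cons_val]
    rw [e3]
    ring

end ChebyshevDihedral

theorem theorem4p1 (d : ℤ) (hd : d ≠ 0) :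
    ChebyshevDihedral.IsMorphismOver ℤ (ChebyshevDihedral.g d) := by
  obtain ⟨n, rfl | rfl⟩ := d.eq_nat_or_neg
  · exact ChebyshevDihedral.isMorphismOver_g_natCast n
  · rw [ChebyshevDihedral.g_neg]
    exact ChebyshevDihedral.isMorphismOver_g_natCast n
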